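/- A continuum is a nonempty compact connected metrizable space. A continuum $X$ is colocally connected if for each $x\in X$ and each neighborhood $V$ of $x$ there is an open set $U$ with $x\in U\subseteq V$ such that $X\setminus U$ is connected (the empty set counts as connected). Let $C(X)$ be the space of nonempty subcontinua of $X$ with the Hausdorff metric (for a metric inducing the topology of $X$). A Whitney map on $C(X)$ is a continuous function $\mu:C(X)\to[0,\mu(X)]$ such that $\mu(\{x\})=0$ for each $x\in X$ and $\mu(A)<\mu(B)$ whenever $A,B\in C(X)$ and $A\subsetneq B$. Theorem 3.2. Colocal connectedness is a Whitney property. That is, if $X$ is a colocally connected continuum and $\mu$ is a Whitney map on $C(X)$, then for every $t\in[0,\mu(X))$ the Whitney level $\mu^{-1}(t)$, as a subspace of $C(X)$, is a colocally connected continuum. -/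

import Mathlib

open Set Topology

universe u

/-- A continuum: a nonempty compact connected metrizable space (possibly a single point). -/
class Continuum (X : Type u) [TopologicalSpace X] : Prop extends
  CompactSpace X, ConnectedSpace X, TopologicalSpace.MetrizableSpace X

/-- `X` is a colocally connected continuum: it is a continuum, and every neighborhood `V` of every
point `x` contains an open neighborhood `U` of `x` with connected complement. Here the empty set
counts as connected; when `X` has at least two points, excluding it gives the same notion (replace
`V` by `V` minus another point). -/
class ColocallyConnected (X : Type u) [TopologicalSpace X] : Prop extends Continuum X where
  exists_open : ∀ (x : X), ∀ V ∈ 𝓝 x, ∃ U : Set X,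
    IsOpen U ∧ x ∈ U ∧ U ⊆ V ∧ IsPreconnected Uᶜ

/-- The hyperspace `C(X)` of nonempty subcontinua of `X`. As a subtype of Mathlib's type of nonempty
compact subsets of a metric space, it carries the Hausdorff metric. -/
abbrev Subcontinua (X : Type u) [MetricSpace X] : Type u :=
  {K : TopologicalSpace.NonemptyCompacts X // IsConnected (K : Set X)}

namespace Subcontinua

/-- The one-point subcontinuum `{x}`. -/
def point {X : Type u} [MetricSpace X] (x : X) : Subcontinua X :=
  ⟨{x}, isConnected_singleton⟩

/-- The continuum `X` as an element of `C(X)`. -/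
def whole (X : Type u) [MetricSpace X] [Continuum X] : Subcontinua X :=
  ⟨⊤, isConnected_univ⟩

end Subcontinua

/-- A Whitney map on `C(X)`: continuous, zero on one-point sets, and strictly increasing for
inclusion. Its values automatically lie in `[0, μ(X)]`, since `{x} ⊆ A ⊆ X` for every `x ∈ A`. -/
structure IsWhitneyMap {X : Type u} [MetricSpace X] (μ : Subcontinua X → ℝ) : Prop where
  continuous : Continuous μ
  map_point : ∀ x : X, μ (Subcontinua.point x) = 0
  map_lt_map : ∀ A B : Subcontinua X, (A.1 : Set X) ⊂ (B.1 : Set X) → μ A < μ B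

/-- A property `P` of topological spaces is a Whitney property if, whenever a continuum `X` has it,
so does the Whitney level `μ⁻¹(t)`, with the subspace topology from `C(X)`, for each Whitney map
`μ` on `C(X)` and each `t ∈ [0, μ(X))`. -/
def IsWhitneyProperty (P : ∀ (Y : Type u) [TopologicalSpace Y], Prop) : Prop :=
  ∀ (X : Type u) [MetricSpace X] [Continuum X], P X →
    ∀ μ : Subcontinua X → ℝ, IsWhitneyMap μ →
      ∀ t ∈ Ico 0 (μ (Subcontinua.whole X)), P ↥(μ ⁻¹' {t})

/-!
Order arcs exist in `C(X)`: by boundary bumping the inclusion order on `C(X)` is dense, so a Whitney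
map sends a maximal chain homeomorphically onto an interval
(`StrictMono.exists_continuous_monotone_section`). Hence every subcontinuum of size at most `t` lies
in one of size `t`, and the members of the level `μ⁻¹(t)` through a given point form a connected set
(`IsWhitneyMap.isPreconnected_setOf_ge`). It follows that the members meeting a closed set `Z` form
a connected set as soon as every partition of `Z` into two closed sets `P` and `Q` is bridged by a
member of the level (`IsWhitneyMap.isPreconnected_level_inter_nonempty`). With `Z = X` this shows
that the level is connected.

For colocal connectedness at `A`, a neighborhood of `A` in the level is given by the continua
contained in an open set `U ⊇ A`, and its complement by those meeting `Uᶜ`. The complement of `U`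
itself need not be connected, but `U` can be taken as the union of a small open set `V` around a
point `a ∈ A`, with `Vᶜ` connected, and a much thinner neighborhood `N` of `A`. If `Uᶜ` splits
into closed sets `P` and `Q`, then some continuum in `Vᶜ` joins them inside the closure of `N`.
Such a continuum almost lies in `A \ V`, a proper subset of `A`, so its size is less than `t`, and
a continuum of size `t` containing it bridges `P` and `Q` (`IsWhitneyMap.exists_open_level`).
-/

open TopologicalSpace

/-! ### Connectedness in compact Hausdorff spaces -/

/-- Let `R` be a compact relation whose fibres over the first factor are preconnected. A separation
of the range of `R` cuts no fibre, so it induces a separation of the domain into closed sets `P` and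
`Q`. If no such `P` and `Q` can have disjoint images under `R`, then the range is preconnected. -/
theorem IsCompact.isPreconnected_image_snd_of_link {X Y : Type*} [TopologicalSpace X]
    [TopologicalSpace Y] [T2Space X] [T2Space Y] {R : Set (X × Y)} (hR : IsCompact R)
    (hfib : ∀ x, IsPreconnected {y | (x, y) ∈ R})
    (hlink : ∀ P Q : Set X, IsClosed P → IsClosed Q → Disjoint P Q → P ∪ Q = Prod.fst '' R →
      P.Nonempty → Q.Nonempty → ∃ p ∈ P, ∃ q ∈ Q, ∃ y, (p, y) ∈ R ∧ (q, y) ∈ R) :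
    IsPreconnected (Prod.snd '' R) := by
  have hcl : IsClosed (Prod.snd '' R) := (hR.image continuous_snd).isClosed
  rw [isPreconnected_iff_subset_of_fully_disjoint_closed hcl]
  intro U V hU hV hUV hd
  have hmem : ∀ {x y}, (x, y) ∈ R → y ∈ U ∪ V := fun h => hUV ⟨_, h, rfl⟩
  -- Each fibre lies entirely in `U` or entirely in `V`.
  have hside : ∀ x, {y | (x, y) ∈ R} ⊆ U ∨ {y | (x, y) ∈ R} ⊆ V := fun x =>
    isPreconnected_iff_subset_of_disjoint_closed.1 (hfib x) U V hU hV (fun _ hy => hmem hy)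
      (by rw [hd.inter_eq, inter_empty])
  have hswitch : ∀ {x y y'}, (x, y) ∈ R → (x, y') ∈ R → y ∈ U → y' ∈ U := by
    intro x y y' h h' hy
    rcases hside x with hx | hx
    · exact hx h'
    · exact (disjoint_left.1 hd hy (hx h)).elim
  by_contra! hcon
  obtain ⟨⟨y₁, ⟨⟨x₁, y₁⟩, h₁, rfl⟩, hy₁⟩, ⟨y₂, ⟨⟨x₂, y₂⟩, h₂, rfl⟩, hy₂⟩⟩ :=
    And.intro (not_subset.1 hcon.1) (not_subset.1 hcon.2)
  have hproj : ∀ W : Set Y, IsClosed W → IsClosed (Prod.fst '' (R ∩ Prod.snd ⁻¹' W)) :=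
    fun W hW => ((hR.inter_right (hW.preimage continuous_snd)).image continuous_fst).isClosed
  obtain ⟨p, ⟨⟨p, u⟩, ⟨hpu, hu⟩, rfl⟩, q, ⟨⟨q, v⟩, ⟨hqv, hv⟩, rfl⟩, y, hpy, hqy⟩ :=
    hlink _ _ (hproj U hU) (hproj V hV)
      (by
        rw [disjoint_left]
        rintro _ ⟨⟨x, u⟩, ⟨hu, huU⟩, rfl⟩ ⟨⟨x', v⟩, ⟨hv, hvV⟩, hx⟩
        obtain rfl : x' = x := hx
        exact disjoint_left.1 hd (hswitch hu hv huU) hvV)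
      (by
        have hR' : R ⊆ Prod.snd ⁻¹' (U ∪ V) := fun z hz => hmem hz
        rw [← image_union, ← inter_union_distrib_left, ← preimage_union, inter_eq_left.2 hR'])
      ⟨x₂, (x₂, y₂), ⟨h₂, (hmem h₂).resolve_right hy₂⟩, rfl⟩
      ⟨x₁, (x₁, y₁), ⟨h₁, (hmem h₁).resolve_left hy₁⟩, rfl⟩
  exact disjoint_left.1 hd (hswitch hqy hqv (hswitch hpu hpy hu)) hv

theorem IsCompact.isPreconnected_image_snd {X Y : Type*} [TopologicalSpace X]
    [TopologicalSpace Y] [T2Space X] [T2Space Y] {R : Set (X × Y)} (hR : IsCompact R)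
    (hfib : ∀ x, IsPreconnected {y | (x, y) ∈ R}) (hfst : IsPreconnected (Prod.fst '' R)) :
    IsPreconnected (Prod.snd '' R) := by
  refine IsCompact.isPreconnected_image_snd_of_link hR hfib fun P Q hP hQ hPQ hu hPne hQne => ?_
  obtain ⟨x, -, hxP, hxQ⟩ := isPreconnected_closed_iff.1 hfst P Q hP hQ hu.ge
    (by rwa [← hu, inter_eq_right.2 subset_union_left])
    (by rwa [← hu, inter_eq_right.2 subset_union_right])
  exact (disjoint_left.1 hPQ hxP hxQ).elim

/-- In a compact Hausdorff space, closed sets met by no common component are separated by a clopen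
set, because the space of components is profinite. -/
theorem exists_isClopen_of_connectedComponent {Y : Type*} [TopologicalSpace Y] [CompactSpace Y]
    [T2Space Y] {A B : Set Y} (hA : IsClosed A) (hB : IsClosed B)
    (h : ∀ y, (connectedComponent y ∩ A).Nonempty → ¬(connectedComponent y ∩ B).Nonempty) :
    ∃ C : Set Y, IsClopen C ∧ A ⊆ C ∧ Disjoint C B := by
  have hcont := ConnectedComponents.continuous_coe (α := Y)
  have hsub : ((↑) : Y → ConnectedComponents Y) '' A ⊆ ((↑) '' B)ᶜ := by
    rintro _ ⟨a, ha, rfl⟩ ⟨b, hb, hab⟩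
    rw [ConnectedComponents.coe_eq_coe'] at hab
    exact h a ⟨a, mem_connectedComponent, ha⟩ ⟨b, hab, hb⟩
  obtain ⟨C, hC, hAC, hCB⟩ := exists_clopen_of_closed_subset_open
    (hA.isCompact.image hcont).isClosed (hB.isCompact.image hcont).isClosed.isOpen_compl hsub
  refine ⟨(↑) ⁻¹' C, hC.preimage hcont, image_subset_iff.1 hAC, ?_⟩
  rw [disjoint_left]
  exact fun y hy hyB => hCB hy ⟨y, hyB, rfl⟩

/-- The cut-wire theorem: in a compact set `N`, closed sets `P` and `Q` are either joined by a
continuum in `N` or separated by a partition of `N` into two closed sets. -/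
theorem exists_isConnected_subset_or_exists_separation {X : Type*} [TopologicalSpace X] [T2Space X]
    {N P Q : Set X} (hN : IsCompact N) (hP : IsClosed P) (hQ : IsClosed Q) :
    (∃ D ⊆ N, IsCompact D ∧ IsConnected D ∧ (D ∩ P).Nonempty ∧ (D ∩ Q).Nonempty) ∨
    ∃ N₁ N₂ : Set X, IsClosed N₁ ∧ IsClosed N₂ ∧ N₁ ∪ N₂ = N ∧ Disjoint N₁ N₂ ∧
      Disjoint N₁ Q ∧ Disjoint N₂ P := by
  have := isCompact_iff_compactSpace.1 hN
  by_cases h : ∀ y : N, (connectedComponent y ∩ (↑) ⁻¹' P).Nonempty →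
      ¬(connectedComponent y ∩ (↑) ⁻¹' Q).Nonempty
  · right
    obtain ⟨C, hC, hPC, hCQ⟩ := exists_isClopen_of_connectedComponent
      (hP.preimage continuous_subtype_val) (hQ.preimage continuous_subtype_val) h
    have himg : ∀ C : Set N, IsClosed C → IsClosed (((↑) : N → X) '' C) :=
      fun C hC => (hC.isCompact.image continuous_subtype_val).isClosed
    refine ⟨(↑) '' C, (↑) '' Cᶜ, himg _ hC.1, himg _ hC.compl.1, ?_, ?_, ?_, ?_⟩
    · rw [← image_union, union_compl_self, image_univ, Subtype.range_coe]
    · exact (disjoint_image_iff Subtype.val_injective).2 disjoint_compl_right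
    · rw [disjoint_left]
      rintro _ ⟨x, hx, rfl⟩ hxQ
      exact disjoint_left.1 hCQ hx hxQ
    · rw [disjoint_left]
      rintro _ ⟨x, hx, rfl⟩ hxP
      exact hx (hPC hxP)
  · left
    push Not at h
    obtain ⟨y, ⟨p, hp, hpP⟩, ⟨q, hq, hqQ⟩⟩ := h
    exact ⟨(↑) '' connectedComponent y, Subtype.coe_image_subset _ _,
      isClosed_connectedComponent.isCompact.image continuous_subtype_val,
      isConnected_connectedComponent.image _ continuous_subtype_val.continuousOn,
      ⟨p, ⟨p, hp, rfl⟩, hpP⟩, ⟨q, ⟨q, hq, rfl⟩, hqQ⟩⟩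

/-- A continuum `M` that meets the disjoint closed sets `P` and `Q` contains a subcontinuum that
joins them inside the closure of `M \ (P ∪ Q)`: otherwise the cut-wire theorem separates that
closure, hence `M`, between `P` and `Q`. -/
theorem IsPreconnected.exists_isConnected_subset_closure_diff {X : Type*} [TopologicalSpace X]
    [T2Space X] {M P Q : Set X} (hM : IsPreconnected M) (hMc : IsCompact M) (hP : IsClosed P)
    (hQ : IsClosed Q) (hPQ : Disjoint P Q) (hMP : (M ∩ P).Nonempty) (hMQ : (M ∩ Q).Nonempty) :
    ∃ D ⊆ M ∩ closure (M \ (P ∪ Q)), IsCompact D ∧ IsConnected D ∧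
      (D ∩ P).Nonempty ∧ (D ∩ Q).Nonempty := by
  refine (exists_isConnected_subset_or_exists_separation
    (hMc.inter_right isClosed_closure) hP hQ).resolve_right ?_
  rintro ⟨N₁, N₂, h₁, h₂, hN, hd, hd₁, hd₂⟩
  have hcov : M ⊆ (P ∪ N₁) ∪ (Q ∪ N₂) := by
    intro x hx
    by_cases hxPQ : x ∈ P ∪ Q
    · exact hxPQ.imp Or.inl Or.inl
    · have : x ∈ N₁ ∪ N₂ := hN ▸ ⟨hx, subset_closure ⟨hx, hxPQ⟩⟩
      exact this.imp Or.inr Or.inr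
  have hdis : Disjoint (P ∪ N₁) (Q ∪ N₂) := by
    simp only [disjoint_union_left, disjoint_union_right]
    exact ⟨⟨hPQ, hd₁⟩, hd₂.symm, hd⟩
  obtain ⟨x, -, hx₁, hx₂⟩ := isPreconnected_closed_iff.1 hM _ _ (hP.union h₁) (hQ.union h₂) hcov
    (hMP.mono (inter_subset_inter_right _ subset_union_left))
    (hMQ.mono (inter_subset_inter_right _ subset_union_left))
  exact disjoint_left.1 hdis hx₁ hx₂

/-- Between two nested distinct continua lies a third one. This is a form of boundary bumping: join
`E` inside `F` to a closed neighborhood of a point `x ∈ F \ E`, and add the joining continuum,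
which avoids `x`, to `E`. -/
theorem IsConnected.exists_isConnected_ssubset_ssubset {X : Type*} [TopologicalSpace X] [T2Space X]
    [RegularSpace X] {E F : Set X} (hE : IsConnected E) (hF : IsConnected F) (hEc : IsCompact E)
    (hFc : IsCompact F) (hEF : E ⊂ F) :
    ∃ G, IsCompact G ∧ IsConnected G ∧ E ⊂ G ∧ G ⊂ F := by
  obtain ⟨x, hxF, hxE⟩ := exists_of_ssubset hEF
  obtain ⟨Q, hQx, hQ, hQE⟩ := exists_mem_nhds_isClosed_subset
    (hEc.isClosed.isOpen_compl.mem_nhds hxE)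
  obtain ⟨D, hDF, hDc, hD, ⟨e, heD, heE⟩, ⟨q, hqD, hqQ⟩⟩ :=
    hF.isPreconnected.exists_isConnected_subset_closure_diff hFc hEc.isClosed hQ
      (disjoint_right.2 hQE) (hE.nonempty.mono (subset_inter hEF.subset subset_rfl))
      ⟨x, hxF, mem_of_mem_nhds hQx⟩
  refine ⟨E ∪ D, hEc.union hDc, hE.union ⟨e, heE, heD⟩ hD,
    ssubset_iff_of_subset subset_union_left |>.2 ⟨q, Or.inr hqD, hQE hqQ⟩,
    ssubset_iff_of_subset (union_subset hEF.subset (hDF.trans inter_subset_left)) |>.2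
      ⟨x, hxF, ?_⟩⟩
  rintro (hx | hx)
  · exact hxE hx
  · obtain ⟨z, hzQ, hz⟩ := mem_closure_iff_nhds.1 (hDF hx).2 Q hQx
    exact hz.2 (Or.inr hzQ)

/-! ### The hyperspace of subcontinua -/

namespace Subcontinua

variable {X : Type u} [MetricSpace X]

/-- A separation of a compact set `K` extends to disjoint open sets `U` and `V`, which separate every
compact set close enough to `K`. -/
theorem isClosed_setOf_isConnected :
    IsClosed {K : NonemptyCompacts X | IsConnected (K : Set X)} := by
  rw [← isOpen_compl_iff, isOpen_iff_mem_nhds]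
  intro K hK
  have hK' : ¬IsPreconnected (K : Set X) := fun h => hK ⟨K.nonempty, h⟩
  rw [isPreconnected_iff_subset_of_fully_disjoint_closed K.isCompact.isClosed] at hK'
  push Not at hK'
  obtain ⟨u, v, hu, hv, hKuv, huv, hKu, hKv⟩ := hK'
  obtain ⟨U, V, hU, hV, huU, hvV, hUV⟩ := SeparatedNhds.of_isCompact_isCompact
    (K.isCompact.inter_right hu) (K.isCompact.inter_right hv)
    (huv.mono inter_subset_right inter_subset_right)
  obtain ⟨x, hx, hxu⟩ := not_subset.1 hKu
  obtain ⟨y, hy, hyv⟩ := not_subset.1 hKv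
  filter_upwards [(NonemptyCompacts.isOpen_subsets_of_isOpen (hU.union hV)).mem_nhds
      (show (K : Set X) ⊆ U ∪ V from fun z hz =>
        (hKuv hz).imp (fun h => huU ⟨hz, h⟩) fun h => hvV ⟨hz, h⟩),
    (NonemptyCompacts.isOpen_inter_nonempty_of_isOpen hV).mem_nhds
      (show ((K : Set X) ∩ V).Nonempty from ⟨x, hx, hvV ⟨hx, (hKuv hx).resolve_left hxu⟩⟩),
    (NonemptyCompacts.isOpen_inter_nonempty_of_isOpen hU).mem_nhds
      (show ((K : Set X) ∩ U).Nonempty from ⟨y, hy, huU ⟨hy, (hKuv hy).resolve_right hyv⟩⟩)]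
    with L hL hLV hLU hLc
  obtain ⟨z, -, hzU, hzV⟩ := hLc.isPreconnected U V hU hV hL hLU hLV
  exact disjoint_left.1 hUV hzU hzV

instance [CompactSpace X] : CompactSpace (Subcontinua X) :=
  isCompact_iff_compactSpace.1 isClosed_setOf_isConnected.isCompact

instance : OrderClosedTopology (Subcontinua X) where
  isClosed_le' := by
    have h : {p : Subcontinua X × Subcontinua X | p.1 ≤ p.2} =
        {p | p.1.1 ⊔ p.2.1 = p.2.1} := by
      ext p
      exact (sup_eq_right (a := p.1.1) (b := p.2.1)).symm
    rw [h]
    exact isClosed_eq (by fun_prop) (by fun_prop)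

theorem continuous_point : Continuous (point : X → Subcontinua X) :=
  NonemptyCompacts.continuous_singleton.subtype_mk _

theorem point_le_iff {x : X} {A : Subcontinua X} : point x ≤ A ↔ x ∈ (A.1 : Set X) := by
  change ((({x} : NonemptyCompacts X) : Set X) ⊆ A.1) ↔ _
  simp

/-- The union of two subcontinua that have a common point. -/
def union (A B : Subcontinua X) (h : ((A.1 : Set X) ∩ B.1).Nonempty) : Subcontinua X :=
  ⟨A.1 ⊔ B.1, by
    rw [NonemptyCompacts.coe_sup]
    exact A.2.union h B.2⟩

instance : DenselyOrdered (Subcontinua X) where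
  dense A B h := by
    obtain ⟨G, hGc, hG, hAG, hGB⟩ := A.2.exists_isConnected_ssubset_ssubset B.2 A.1.isCompact
      B.1.isCompact h
    exact ⟨⟨⟨⟨G, hGc⟩, hG.nonempty⟩, hG⟩, hAG, hGB⟩

end Subcontinua

/-! ### Maximal chains and order arcs -/

/-- By maximality, a flag is the set of all elements comparable with each of its members. -/
theorem Flag.isClosed {α : Type*} [PartialOrder α] [TopologicalSpace α] [OrderClosedTopology α]
    (s : Flag α) : IsClosed (s : Set α) := by
  have h : (s : Set α) = ⋂ b ∈ s, {a | a ≤ b ∨ b ≤ a} := by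
    ext a
    simp only [mem_iInter, SetLike.mem_coe]
    exact s.mem_iff_forall_le_or_ge
  rw [h]
  exact isClosed_biInter fun b _ =>
    (isClosed_le continuous_id continuous_const).union (isClosed_le continuous_const continuous_id)

theorem Flag.le_of_apply_le {α β : Type*} [PartialOrder α] [Preorder β] {f : α → β}
    (hmono : StrictMono f) (s : Flag α) {a b : α} (ha : a ∈ s) (hb : b ∈ s) (hab : f a ≤ f b) :
    a ≤ b :=
  (s.le_or_le ha hb).elim id fun h => (h.eq_of_not_lt fun h' => (hmono h').not_ge hab).ge

/-- A strictly increasing continuous real function takes all intermediate values on a maximal chain: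
a gap in the values would lie between consecutive members of the chain, and an element strictly
between those two could be added to it. -/
theorem Flag.exists_apply_eq {α : Type*} [PartialOrder α] [TopologicalSpace α]
    [OrderClosedTopology α] [CompactSpace α] [DenselyOrdered α] {f : α → ℝ} (hf : Continuous f)
    (hmono : StrictMono f) (s : Flag α) {a b : α} (ha : a ∈ s) (hb : b ∈ s) {r : ℝ}
    (hr : r ∈ Icc (f a) (f b)) : ∃ c ∈ s, f c = r := by
  obtain ⟨d, ⟨hds, hdr⟩, hd⟩ := (s.isClosed.inter
    (isClosed_le hf continuous_const)).isCompact.exists_isMaxOn (f := f)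
    ⟨a, ha, hr.1⟩ hf.continuousOn
  obtain ⟨e, ⟨hes, her⟩, he⟩ := (s.isClosed.inter
    (isClosed_le continuous_const hf)).isCompact.exists_isMinOn (f := f)
    ⟨b, hb, hr.2⟩ hf.continuousOn
  by_contra! hcon
  have hdr' : f d < r := lt_of_le_of_ne hdr (hcon d hds)
  have her' : r < f e := lt_of_le_of_ne her (hcon e hes).symm
  have hle : ∀ x ∈ s, ∀ y ∈ s, f x ≤ f y → x ≤ y := fun _ hx _ hy => s.le_of_apply_le hmono hx hy
  have hde : d < e := lt_of_le_of_ne (hle d hds e hes (hdr'.trans her').le)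
    fun h => (hdr'.trans her').ne (h ▸ rfl)
  obtain ⟨c, hdc, hce⟩ := exists_between hde
  have hcs : c ∈ s := s.mem_iff_forall_le_or_ge.2 fun x hx => by
    rcases le_total (f x) r with h | h
    · exact Or.inr ((hle x hx d hds (hd ⟨hx, h⟩)).trans hdc.le)
    · exact Or.inl (hce.le.trans (hle e hes x hx (he ⟨hx, h⟩)))
  rcases le_total (f c) r with h | h
  · exact (hmono hdc).not_ge (hd ⟨hcs, h⟩)
  · exact (hmono hce).not_ge (he ⟨hcs, h⟩)

/-- Order arcs: `a ≤ b` are joined by an increasing path `γ` parametrized by the values of `f`. It is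
the inverse of the restriction of `f` to a maximal chain through `a` and `b`, a continuous bijection
from a compact space. Outside `[f a, f b]` the path is extended by the constants `a` and `b`. -/
theorem StrictMono.exists_continuous_monotone_section {α : Type*} [PartialOrder α]
    [TopologicalSpace α] [OrderClosedTopology α] [CompactSpace α] [DenselyOrdered α] {f : α → ℝ}
    (hmono : StrictMono f) (hf : Continuous f) {a b : α} (hab : a ≤ b) :
    ∃ γ : ℝ → α, Continuous γ ∧ Monotone γ ∧ (∀ r ≤ f a, γ r = a) ∧ (∀ r, f b ≤ r → γ r = b) ∧
      ∀ r ∈ Icc (f a) (f b), f (γ r) = r := by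
  obtain ⟨s, hs⟩ := (IsChain.pair hab).exists_subset_flag
  have ha : a ∈ s := hs (mem_insert _ _)
  have hb : b ∈ s := hs (mem_insert_of_mem _ rfl)
  have hle : ∀ x ∈ s, ∀ y ∈ s, f x ≤ f y → x ≤ y := fun _ hx _ hy => s.le_of_apply_le hmono hx hy
  let K : Set α := (s : Set α) ∩ f ⁻¹' Icc (f a) (f b)
  have hK : CompactSpace K := isCompact_iff_compactSpace.1
    (s.isClosed.inter (isClosed_Icc.preimage hf)).isCompact
  let g : K → Icc (f a) (f b) := fun x => ⟨f x, x.2.2⟩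
  have hg : Continuous g := by fun_prop
  have hbij : Function.Bijective g := by
    refine ⟨fun x y hxy => Subtype.ext ?_, fun r => ?_⟩
    · have h : f x = f y := congrArg Subtype.val hxy
      exact (hle x x.2.1 y y.2.1 h.le).antisymm (hle y y.2.1 x x.2.1 h.ge)
    · obtain ⟨c, hc, hcr⟩ := s.exists_apply_eq hf hmono ha hb r.2
      exact ⟨⟨c, hc, mem_preimage.2 (hcr.symm ▸ r.2)⟩, Subtype.ext hcr⟩
  let e := Equiv.ofBijective g hbij
  have he : Continuous e.symm := hg.continuous_symm_of_equiv_compact_to_t2 (f := e)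
  have hfe : ∀ r : Icc (f a) (f b), f (e.symm r) = r := fun r =>
    congrArg Subtype.val (e.apply_symm_apply r)
  have hfab : f a ≤ f b := hmono.monotone hab
  have hinj : ∀ r : Icc (f a) (f b), ∀ c ∈ s, f c = r → (e.symm r : α) = c := fun r c hc h =>
    (hle _ (e.symm r).2.1 c hc ((hfe r).trans h.symm).le).antisymm
      (hle c hc _ (e.symm r).2.1 ((hfe r).trans h.symm).ge)
  refine ⟨IccExtend hfab fun r => (e.symm r : α), (continuous_subtype_val.comp he).Icc_extend',
    Monotone.IccExtend hfab fun r r' h => hle _ (e.symm r).2.1 _ (e.symm r').2.1 ?_, fun r hr => ?_,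
    fun r hr => ?_, fun r hr => ?_⟩
  · rw [hfe, hfe]
    exact h
  · rw [IccExtend_of_le_left _ _ hr]
    exact hinj _ a ha rfl
  · rw [IccExtend_of_right_le _ _ hr]
    exact hinj _ b hb rfl
  · rw [IccExtend_of_mem _ _ hr]
    exact hfe _

/-! ### Whitney levels above a continuum -/

namespace IsWhitneyMap

open Subcontinua

variable {X : Type u} [MetricSpace X] {μ : Subcontinua X → ℝ}

theorem strictMono (hμ : IsWhitneyMap μ) : StrictMono μ := fun A B h => hμ.map_lt_map A B h

variable [CompactSpace X]

theorem exists_ge_of_le (hμ : IsWhitneyMap μ) {A B : Subcontinua X} (hAB : A ≤ B) {t : ℝ}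
    (ht : t ∈ Icc (μ A) (μ B)) : ∃ C, A ≤ C ∧ μ C = t := by
  obtain ⟨γ, -, hm, hA, -, hγ⟩ := hμ.strictMono.exists_continuous_monotone_section hμ.continuous hAB
  exact ⟨γ t, (hA _ le_rfl).ge.trans (hm ht.1), hγ t ht⟩

/-- The members of a Whitney level that contain a given continuum `A` form a connected set. Let `α`
and `β` be order arcs from `A` to two of them. For each shift `c`, the increasing family
`s ↦ α s ∪ β (s + c)` meets the level in exactly one continuum. As `c` runs through an interval,
this continuum moves from the end of `α` to the end of `β`. -/
theorem isPreconnected_setOf_ge (hμ : IsWhitneyMap μ) (A : Subcontinua X) (t : ℝ) :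
    IsPreconnected {B | A ≤ B ∧ μ B = t} := by
  refine isPreconnected_of_forall_pair ?_
  rintro B₁ ⟨hAB₁, hB₁⟩ B₂ ⟨hAB₂, hB₂⟩
  obtain ⟨α, hαc, hαm, hαl, hαr, -⟩ :=
    hμ.strictMono.exists_continuous_monotone_section hμ.continuous hAB₁
  obtain ⟨β, hβc, hβm, hβl, hβr, -⟩ :=
    hμ.strictMono.exists_continuous_monotone_section hμ.continuous hAB₂
  rw [hB₁] at hαr
  rw [hB₂] at hβr
  -- The arcs are equal to `A` to the left of `μ A`, so by monotonicity all values contain `A`.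
  have hαA : ∀ s, A ≤ α s := fun s => by
    rw [← hαl _ (min_le_right s (μ A))]
    exact hαm (min_le_left _ _)
  have hβA : ∀ s, A ≤ β s := fun s => by
    rw [← hβl _ (min_le_right s (μ A))]
    exact hβm (min_le_left _ _)
  have hpt : μ A ≤ t := hB₁ ▸ hμ.strictMono.monotone hAB₁
  have hne : ∀ s r, (((α s).1 : Set X) ∩ (β r).1).Nonempty := fun s r =>
    A.2.nonempty.mono (subset_inter (hαA s) (hβA r))
  set d := t - μ A with hd
  have hd0 : 0 ≤ d := sub_nonneg.2 hpt
  let φ : ℝ × ℝ → Subcontinua X := fun q => (α q.2).union (β (q.2 + q.1)) (hne _ _)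
  have hφ : Continuous φ := by
    refine Continuous.subtype_mk ?_ _
    fun_prop
  have hφ_mono : ∀ c s s', s ≤ s' → φ (c, s) ≤ φ (c, s') := fun c s s' h =>
    sup_le_sup (α := NonemptyCompacts X) (hαm h) (hβm (add_le_add_left h c))
  -- For `|c| ≤ d` the bounds on `s` put both arcs at `A` on the left and at their ends on the right.
  let K : Set (ℝ × ℝ) := (Icc (-d) d ×ˢ Icc (μ A - d) (t + d)) ∩ {q | μ (φ q) = t}
  have hK : IsCompact K := (isCompact_Icc.prod isCompact_Icc).inter_right
    (isClosed_eq (hμ.continuous.comp hφ) continuous_const)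
  let R : Set (ℝ × Subcontinua X) := (fun q => (q.1, φ q)) '' K
  have hR : IsCompact R := hK.image (by fun_prop)
  have hfst : Prod.fst '' R = Icc (-d) d := by
    rw [image_image]
    refine Subset.antisymm ?_ fun c hc => ?_
    · rintro _ ⟨q, hq, rfl⟩
      exact hq.1.1
    · have hcont : Continuous fun s => μ (φ (c, s)) := by
        have := hμ.continuous
        fun_prop
      have h₁ : μ (φ (c, μ A - d)) ≤ t := by
        refine (hμ.strictMono.monotone (?_ : _ ≤ A)).trans hpt
        refine sup_le (α := NonemptyCompacts X) (hαl _ (by linarith)).le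
          (hβl _ (by linarith [hc.2])).le
      have h₂ : t ≤ μ (φ (c, t + d)) := by
        refine hB₁.ge.trans (hμ.strictMono.monotone ?_)
        exact (hαr (t + d) (by linarith)).ge.trans
          (le_sup_left : (α (t + d)).1 ≤ _)
      obtain ⟨s, hs, hst⟩ := intermediate_value_Icc (by linarith) hcont.continuousOn ⟨h₁, h₂⟩
      exact ⟨(c, s), ⟨⟨hc, hs⟩, hst⟩, rfl⟩
  refine ⟨Prod.snd '' R, ?_, ?_, ?_, hR.isPreconnected_image_snd ?_ ?_⟩
  · rintro _ ⟨_, ⟨q, hq, rfl⟩, rfl⟩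
    exact ⟨(hαA q.2).trans (le_sup_left : (α q.2).1 ≤ _), hq.2⟩
  · have h : φ (-d, t) = B₁ := by
      refine Subtype.ext ?_
      change (α t).1 ⊔ (β (t + -d)).1 = _
      rw [hαr t le_rfl, hβl _ (by linarith)]
      exact sup_eq_left.2 hAB₁
    exact ⟨(-d, B₁), ⟨(-d, t), ⟨⟨⟨le_rfl, by linarith⟩, by linarith, by linarith⟩,
      (congrArg μ h).trans hB₁⟩, Prod.ext rfl h⟩, rfl⟩
  · have h : φ (d, μ A) = B₂ := by
      refine Subtype.ext ?_
      change (α (μ A)).1 ⊔ (β (μ A + d)).1 = _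
      rw [hαl _ le_rfl, hβr _ (by linarith)]
      exact sup_eq_right.2 hAB₂
    exact ⟨(d, B₂), ⟨(d, μ A), ⟨⟨⟨by linarith, le_rfl⟩, by linarith, by linarith⟩,
      (congrArg μ h).trans hB₂⟩, Prod.ext rfl h⟩, rfl⟩
  · intro c
    refine Set.Subsingleton.isPreconnected ?_
    rintro _ ⟨⟨c₁, s₁⟩, ⟨-, h₁⟩, heq₁⟩ _ ⟨⟨c₂, s₂⟩, ⟨-, h₂⟩, heq₂⟩
    obtain ⟨rfl, rfl⟩ := Prod.mk.inj heq₁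
    obtain ⟨rfl, rfl⟩ := Prod.mk.inj heq₂
    -- Both values lie on one increasing family and have the same size, so they coincide.
    have hμeq : μ (φ (c₂, s₁)) = μ (φ (c₂, s₂)) := Eq.trans h₁ (Eq.symm h₂)
    rcases le_total s₁ s₂ with h | h
    · exact (hφ_mono c₂ _ _ h).eq_of_not_lt fun h' => (hμ.strictMono h').ne hμeq
    · exact ((hφ_mono c₂ _ _ h).eq_of_not_lt fun h' => (hμ.strictMono h').ne hμeq.symm).symm
  · rw [hfst]
    exact isPreconnected_Icc

end IsWhitneyMap

/-! ### Neighborhoods in a Whitney level -/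

namespace Subcontinua

variable {X : Type u} [MetricSpace X] [CompactSpace X]

/-- A compactness argument: if no member of a closed family is contained in `A`, then none is
contained in a small enough neighborhood of `A`. -/
theorem exists_cthickening_of_forall_not_le {A : Subcontinua X} {S : Set (Subcontinua X)}
    (hS : IsClosed S) (hA : ∀ B ∈ S, ¬B ≤ A) :
    ∃ δ > 0, ∀ B ∈ S, ¬(B.1 : Set X) ⊆ Metric.cthickening δ A.1 := by
  by_contra! hcon
  let F : Ioi (0 : ℝ) → Set (Subcontinua X) :=
    fun δ => S ∩ {B | (B.1 : Set X) ⊆ Metric.cthickening δ A.1}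
  have hF : ∀ δ, IsClosed (F δ) := fun δ => hS.inter
    ((NonemptyCompacts.isClosed_subsets_of_isClosed Metric.isClosed_cthickening).preimage
      continuous_subtype_val)
  have : Nonempty (Ioi (0 : ℝ)) := ⟨⟨1, mem_Ioi.2 one_pos⟩⟩
  have hdir : Directed (· ⊇ ·) F := fun δ ε => by
    refine ⟨⟨min δ ε, mem_Ioi.2 (lt_min δ.2 ε.2)⟩, ?_, ?_⟩
    · exact inter_subset_inter_right _ fun B hB =>
        hB.trans (Metric.cthickening_mono (min_le_left _ _) _)
    · exact inter_subset_inter_right _ fun B hB =>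
        hB.trans (Metric.cthickening_mono (min_le_right _ _) _)
  obtain ⟨B, hB⟩ := IsCompact.nonempty_iInter_of_directed_nonempty_isCompact_isClosed F hdir
    (fun δ => hcon δ δ.2) (fun δ => (hF δ).isCompact) hF
  rw [mem_iInter] at hB
  refine hA B (hB ⟨1, mem_Ioi.2 one_pos⟩).1 ?_
  change (B.1 : Set X) ⊆ A.1
  rw [← A.1.isCompact.isClosed.closure_eq, Metric.closure_eq_iInter_cthickening]
  exact subset_iInter₂ fun δ hδ => (hB ⟨δ, hδ⟩).2

end Subcontinua

namespace IsWhitneyMap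

open Subcontinua

variable {X : Type u} [MetricSpace X] [Continuum X] {μ : Subcontinua X → ℝ}

/-- The members of a Whitney level that meet a closed set `Z` form a connected set, provided that
every partition of `Z` into two closed sets is bridged by a member of the level. The members
through a fixed point of `Z` form a connected set, so only the partition of `Z` matters. -/
theorem isPreconnected_level_inter_nonempty (hμ : IsWhitneyMap μ) {t : ℝ}
    (ht : t ∈ Icc 0 (μ (whole X))) {Z : Set X} (hZ : IsClosed Z)
    (hlink : ∀ P Q : Set X, IsClosed P → IsClosed Q → Disjoint P Q → P ∪ Q = Z → P.Nonempty →
      Q.Nonempty → ∃ B : Subcontinua X, μ B = t ∧ ((B.1 : Set X) ∩ P).Nonempty ∧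
        ((B.1 : Set X) ∩ Q).Nonempty) :
    IsPreconnected {B | μ B = t ∧ ((B.1 : Set X) ∩ Z).Nonempty} := by
  let R : Set (X × Subcontinua X) := {p | p.1 ∈ Z ∧ point p.1 ≤ p.2 ∧ μ p.2 = t}
  have hR : IsCompact R := ((hZ.preimage continuous_fst).inter
    ((isClosed_le (continuous_point.comp continuous_fst) continuous_snd).inter
      (isClosed_eq (hμ.continuous.comp continuous_snd) continuous_const))).isCompact
  have hsnd : {B | μ B = t ∧ ((B.1 : Set X) ∩ Z).Nonempty} = Prod.snd '' R := by
    ext B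
    constructor
    · rintro ⟨hB, z, hzB, hz⟩
      exact ⟨(z, B), ⟨hz, point_le_iff.2 hzB, hB⟩, rfl⟩
    · rintro ⟨⟨z, B⟩, ⟨hz, hzB, hB⟩, rfl⟩
      exact ⟨hB, z, point_le_iff.1 hzB, hz⟩
  have hfst : Prod.fst '' R = Z := by
    refine Subset.antisymm ?_ fun z hz => ?_
    · rintro _ ⟨p, hp, rfl⟩
      exact hp.1
    · obtain ⟨B, hzB, hB⟩ := hμ.exists_ge_of_le (A := point z) (B := whole X)
        (fun _ _ => mem_univ _) ⟨(hμ.map_point z).le.trans ht.1, ht.2⟩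
      exact ⟨(z, B), ⟨hz, hzB, hB⟩, rfl⟩
  rw [hsnd]
  refine hR.isPreconnected_image_snd_of_link (fun z => ?_) fun P Q hP hQ hPQ hu hPne hQne => ?_
  · by_cases hz : z ∈ Z
    · simpa [R, hz] using hμ.isPreconnected_setOf_ge (point z) t
    · simp [R, hz, isPreconnected_empty]
  · rw [hfst] at hu
    obtain ⟨B, hB, ⟨p, hpB, hp⟩, ⟨q, hqB, hq⟩⟩ := hlink P Q hP hQ hPQ hu hPne hQne
    exact ⟨p, hp, q, hq, B, ⟨hu ▸ Or.inl hp, point_le_iff.2 hpB, hB⟩,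
      hu ▸ Or.inr hq, point_le_iff.2 hqB, hB⟩

theorem continuum_level (hμ : IsWhitneyMap μ) {t : ℝ} (ht : t ∈ Icc 0 (μ (whole X))) :
    Continuum ↥(μ ⁻¹' {t}) := by
  have hc : CompactSpace ↥(μ ⁻¹' {t}) :=
    isCompact_iff_compactSpace.1 (isClosed_singleton.preimage hμ.continuous).isCompact
  have hpre : IsPreconnected (μ ⁻¹' {t}) := by
    have h := hμ.isPreconnected_level_inter_nonempty ht isClosed_univ
      fun P Q hP hQ hPQ hu hPne hQne => by
        obtain ⟨x, -, hxP, hxQ⟩ := isPreconnected_closed_iff.1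
          (isPreconnected_univ (α := X)) P Q hP hQ hu.ge
          (by rwa [univ_inter]) (by rwa [univ_inter])
        exact (disjoint_left.1 hPQ hxP hxQ).elim
    convert h using 1
    ext B
    simpa using fun _ => B.1.nonempty
  obtain ⟨x⟩ : Nonempty X := inferInstance
  obtain ⟨B, -, hB⟩ := hμ.exists_ge_of_le (A := point x) (B := whole X)
    (fun _ _ => mem_univ _) ⟨(hμ.map_point x).le.trans ht.1, ht.2⟩
  have hconn : ConnectedSpace ↥(μ ⁻¹' {t}) := isConnected_iff_connectedSpace.1 ⟨⟨B, hB⟩, hpre⟩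
  exact {}

/-- The core of the argument. The members of the level contained in `U` form a neighborhood of `A`
within `O`, and the remaining members form a connected set. -/
theorem exists_open_level (hμ : IsWhitneyMap μ) (hX : ColocallyConnected X) {t : ℝ}
    (ht : t ∈ Icc 0 (μ (whole X))) {A : Subcontinua X} (hA : μ A = t) {O : Set (Subcontinua X)}
    (hO : IsOpen O) (hAO : A ∈ O) :
    ∃ U : Set X, IsOpen U ∧ (A.1 : Set X) ⊆ U ∧
      (∀ B : Subcontinua X, μ B = t → (B.1 : Set X) ⊆ U → B ∈ O) ∧
      IsPreconnected {B | μ B = t ∧ ((B.1 : Set X) ∩ Uᶜ).Nonempty} := by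
  have hle : ∀ B, t ≤ μ B → B ≤ A → B = A := fun B hB hBA =>
    hBA.eq_of_not_lt fun h => ((hμ.strictMono h).trans_eq hA).not_ge hB
  -- Members of the level inside the `δ`-neighborhood of `A` belong to `O`.
  obtain ⟨δ, hδ, hδO⟩ := exists_cthickening_of_forall_not_le (A := A)
    (S := {B | t ≤ μ B} ∩ Oᶜ)
    ((isClosed_le continuous_const hμ.continuous).inter hO.isClosed_compl)
    fun B hB hBA => hB.2 (hle B hB.1 hBA ▸ hAO)
  obtain ⟨a, ha⟩ := A.1.nonempty
  obtain ⟨V, hV, haV, hVδ, hVc⟩ := hX.exists_open a (Metric.thickening δ A.1)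
    (Metric.isOpen_thickening.mem_nhds (Metric.self_subset_thickening hδ _ ha))
  -- A continuum in `A \ V` is a proper subset of `A`, so its size is below `t`. This persists for
  -- continua in `Vᶜ` that lie in the closed `ε`-neighborhood of `A`.
  obtain ⟨ε, hε, hεV⟩ := exists_cthickening_of_forall_not_le (A := A)
    (S := {B | t ≤ μ B} ∩ {B | (B.1 : Set X) ⊆ Vᶜ})
    ((isClosed_le continuous_const hμ.continuous).inter
      ((NonemptyCompacts.isClosed_subsets_of_isClosed hV.isClosed_compl).preimage
        continuous_subtype_val))
    fun B hB hBA => by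
      obtain rfl := hle B hB.1 hBA
      exact hB.2 ha haV
  let N := Metric.thickening (min δ ε) (A.1 : Set X)
  have hN : IsOpen N := Metric.isOpen_thickening
  refine ⟨N ∪ V, hN.union hV, (Metric.self_subset_thickening (lt_min hδ hε) _).trans
    subset_union_left, fun B hB hBU => ?_, ?_⟩
  · by_contra hBO
    refine hδO B ⟨hB.ge, hBO⟩ (hBU.trans (union_subset ?_ ?_))
    · exact (Metric.thickening_mono (min_le_left _ _) _).trans
        (Metric.thickening_subset_cthickening _ _)
    · exact hVδ.trans (Metric.thickening_subset_cthickening _ _)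
  refine hμ.isPreconnected_level_inter_nonempty ht (hN.union hV).isClosed_compl
    fun P Q hP hQ hPQ hu hPne hQne => ?_
  have hsub : P ∪ Q ⊆ Vᶜ := hu.subset.trans (compl_subset_compl.2 subset_union_right)
  -- Join `P` to `Q` inside the continuum `Vᶜ`. Since `P ∪ Q` is the complement of `N ∪ V`, the
  -- joining continuum lies in the closure of `N`, so it is small and can be enlarged to size `t`.
  obtain ⟨D, hD, hDc, hDconn, hDP, hDQ⟩ := hVc.exists_isConnected_subset_closure_diff
    hV.isClosed_compl.isCompact hP hQ hPQ
    (hPne.mono (subset_inter (subset_union_left.trans hsub) subset_rfl))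
    (hQne.mono (subset_inter (subset_union_right.trans hsub) subset_rfl))
  let C : Subcontinua X := ⟨⟨⟨D, hDc⟩, hDconn.nonempty⟩, hDconn⟩
  have hCt : μ C ≤ t := by
    by_contra! h
    refine hεV C ⟨h.le, fun x hx => (hD hx).1⟩ fun x hx => ?_
    refine closure_minimal ?_ Metric.isClosed_cthickening (hD hx).2
    rw [hu]
    rintro y ⟨hyV, hy⟩
    exact Metric.thickening_subset_cthickening _ _ (Metric.thickening_mono (min_le_right _ _) _
      ((not_notMem.1 hy).resolve_right hyV))
  obtain ⟨B, hCB, hB⟩ := hμ.exists_ge_of_le (A := C) (B := whole X) (fun _ _ => mem_univ _)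
    ⟨hCt, ht.2⟩
  exact ⟨B, hB, hDP.mono (inter_subset_inter_left _ hCB),
    hDQ.mono (inter_subset_inter_left _ hCB)⟩

end IsWhitneyMap

theorem theorem3p2 : IsWhitneyProperty.{u} ColocallyConnected.{u} := by
  intro X _ _ hX μ hμ t ht
  have ht' := Ico_subset_Icc_self ht
  have := hμ.continuum_level ht'
  refine { exists_open := ?_ }
  rintro ⟨A, hA⟩ 𝒱 h𝒱
  obtain ⟨𝒪, h𝒪, h𝒪𝒱⟩ := (mem_nhds_subtype _ _ _).1 h𝒱
  obtain ⟨O, hO𝒪, hO, hAO⟩ := mem_nhds_iff.1 h𝒪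
  obtain ⟨U, hU, hAU, hUO, hUc⟩ := hμ.exists_open_level hX ht' hA hO hAO
  refine ⟨{B | (B.1.1 : Set X) ⊆ U}, ?_, hAU, fun B hB => h𝒪𝒱 (hO𝒪 (hUO B.1 B.2 hB)), ?_⟩
  · exact ((NonemptyCompacts.isOpen_subsets_of_isOpen hU).preimage
      continuous_subtype_val).preimage continuous_subtype_val
  · rw [← IsInducing.subtypeVal.isPreconnected_image]
    convert hUc using 1
    ext B
    simp only [mem_image, mem_compl_iff, mem_ofPred_eq, Subtype.exists, exists_and_right,
      exists_eq_right, inter_compl_nonempty_iff]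
    exact ⟨fun ⟨h, h'⟩ => ⟨h, h'⟩, fun ⟨h, h'⟩ => ⟨h, h'⟩⟩
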